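/- Let $S$ be the following sentence of the language of second order arithmetic: "every partial order $(P,\preceq)$ such that all its initial intervals are finite unions of ideals has no infinite antichains". Here $P\subseteq\mathbb N$; the relation ${\preceq}\subseteq P\times P$, coded by a set of natural numbers through the pairing $(m,n)\mapsto(m+n)^2+m$, is reflexive on $P$, antisymmetric and transitive; an initial interval of $P$ is a set $I\subseteq P$ such that $x\preceq y$ and $y\in I$ imply $x\in I$; an ideal of $P$ is an initial interval $A$ such that any $x,y\in A$ have an upper bound $z\in A$; $I$ is a finite union of ideals if there are a sequence of sets $(A_i)_{i\in\mathbb N}$, coded by a single set, and a number $n$ such that $A_i$ is an ideal of $P$ for every $i<n$ and $I=\bigcup_{i<n}A_i$; an antichain is a set $D\subseteq P$ of pairwise incomparable elements; and a set of natural numbers is infinite if it is unbounded. Then $\mathsf{RCA}_0$ does not prove $S$. Indeed, let $\mathbf{REC}$ be the $\omega$-model whose sets are the computable subsets of $\mathbb N$. Then $\mathbf{REC}$ satisfies $\mathsf{RCA}_0$ and $S$ is false in $\mathbf{REC}$. More precisely, there is a computable partial order $(P,\preceq)$ with an infinite computable antichain such that every computable initial interval of $P$ is the downward closure $\{x\in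 P:(\exists y\in F)\,x\preceq y\}$ of a finite set $F\subseteq P$; and for this $(P,\preceq)$, $\mathbf{REC}$ satisfies that $(P,\preceq)$ is a partial order all of whose initial intervals are finite unions of ideals, but not that $(P,\preceq)$ has no infinite antichains. -/

import Mathlib

/-! The two-sorted language `L₂` of second order arithmetic, a Hilbert calculus for it, the theory
`RCA₀`, and `ω`-models.  Number variables and set variables are both named by natural numbers, in
two disjoint name spaces. -/

namespace SecondOrderArith

/-- Number terms of `L₂`. -/
inductive Term : Type
  | var (x : ℕ) : Term
  | zero : Term
  | one : Term
  | add (s t : Term) : Term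
  | mul (s t : Term) : Term

/-- Formulas of `L₂`.  The atomic formulas are `s = t`, `s < t` and `t ∈ X`; the quantifier `all`
binds a number variable and `allS` binds a set variable. -/
inductive Formula : Type
  | eq (s t : Term) : Formula
  | lt (s t : Term) : Formula
  | mem (t : Term) (X : ℕ) : Formula
  | fls : Formula
  | imp (φ ψ : Formula) : Formula
  | all (x : ℕ) (φ : Formula) : Formula
  | allS (X : ℕ) (φ : Formula) : Formula

namespace Formula

/-! The other connectives and quantifiers are the usual classical abbreviations. -/

def neg (φ : Formula) : Formula := φ.imp fls
def and (φ ψ : Formula) : Formula := (φ.imp ψ.neg).neg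
def or (φ ψ : Formula) : Formula := φ.neg.imp ψ
def iff (φ ψ : Formula) : Formula := (φ.imp ψ).and (ψ.imp φ)
def ex (x : ℕ) (φ : Formula) : Formula := (all x φ.neg).neg
def exS (X : ℕ) (φ : Formula) : Formula := (allS X φ.neg).neg

end Formula

/-! ### Free variables and substitution -/

/-- The number variable `x` occurs in a term. -/
def Term.Occurs (x : ℕ) : Term → Prop
  | .var y => y = x
  | .zero => False
  | .one => False
  | .add s t => s.Occurs x ∨ t.Occurs x
  | .mul s t => s.Occurs x ∨ t.Occurs x

/-- Replace the number variable `x` by the term `u` in a term. -/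
def Term.subst (x : ℕ) (u : Term) : Term → Term
  | .var y => if y = x then u else .var y
  | .zero => .zero
  | .one => .one
  | .add s t => .add (Term.subst x u s) (Term.subst x u t)
  | .mul s t => .mul (Term.subst x u s) (Term.subst x u t)

namespace Formula

/-- The number variable `x` occurs free in a formula. -/
def Free (x : ℕ) : Formula → Prop
  | eq s t => s.Occurs x ∨ t.Occurs x
  | lt s t => s.Occurs x ∨ t.Occurs x
  | mem t _ => t.Occurs x
  | fls => False
  | imp φ ψ => φ.Free x ∨ ψ.Free x
  | all y φ => y ≠ x ∧ φ.Free x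
  | allS _ φ => φ.Free x

/-- The set variable `X` occurs free in a formula. -/
def FreeS (X : ℕ) : Formula → Prop
  | eq _ _ => False
  | lt _ _ => False
  | mem _ Y => Y = X
  | fls => False
  | imp φ ψ => φ.FreeS X ∨ ψ.FreeS X
  | all _ φ => φ.FreeS X
  | allS Y φ => Y ≠ X ∧ φ.FreeS X

/-- Replace the free occurrences of the number variable `x` by the term `u`. -/
def subst (x : ℕ) (u : Term) : Formula → Formula
  | eq s t => eq (Term.subst x u s) (Term.subst x u t)
  | lt s t => lt (Term.subst x u s) (Term.subst x u t)
  | mem t Y => mem (Term.subst x u t) Y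
  | fls => fls
  | imp φ ψ => imp (φ.subst x u) (ψ.subst x u)
  | all y φ => if y = x then all y φ else all y (φ.subst x u)
  | allS Y φ => allS Y (φ.subst x u)

/-- Replace the free occurrences of the set variable `X` by the set variable `U`. -/
def substS (X U : ℕ) : Formula → Formula
  | eq s t => eq s t
  | lt s t => lt s t
  | mem t Y => mem t (if Y = X then U else Y)
  | fls => fls
  | imp φ ψ => imp (φ.substS X U) (ψ.substS X U)
  | all y φ => all y (φ.substS X U)
  | allS Y φ => if Y = X then allS Y φ else allS Y (φ.substS X U)

/-- The term `u` is free for the number variable `x` in a formula: replacing `x` by `u` captures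
no variable. -/
def FreeFor (x : ℕ) (u : Term) : Formula → Prop
  | eq _ _ => True
  | lt _ _ => True
  | mem _ _ => True
  | fls => True
  | imp φ ψ => φ.FreeFor x u ∧ ψ.FreeFor x u
  | all y φ => ¬ (all y φ).Free x ∨ (¬ u.Occurs y ∧ φ.FreeFor x u)
  | allS _ φ => φ.FreeFor x u

/-- The set variable `U` is free for the set variable `X` in a formula. -/
def FreeForS (X U : ℕ) : Formula → Prop
  | eq _ _ => True
  | lt _ _ => True
  | mem _ _ => True
  | fls => True
  | imp φ ψ => φ.FreeForS X U ∧ ψ.FreeForS X U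
  | all _ φ => φ.FreeForS X U
  | allS Y φ => ¬ (allS Y φ).FreeS X ∨ (U ≠ Y ∧ φ.FreeForS X U)

end Formula

/-! ### Provability -/

/-- `Provable T φ`: the formula `φ` is derivable from the theory `T` in the standard Hilbert
calculus for classical two-sorted first order logic with equality for numbers.  Because of the
generalization rules, a formula of `T` with free variables has the same force as its universal
closure. -/
inductive Provable (T : Set Formula) : Formula → Prop
  | hyp {φ : Formula} : φ ∈ T → Provable T φ
  | mp {φ ψ : Formula} : Provable T (φ.imp ψ) → Provable T φ → Provable T ψ
  | gen {φ : Formula} (x : ℕ) : Provable T φ → Provable T (.all x φ)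
  | genS {φ : Formula} (X : ℕ) : Provable T φ → Provable T (.allS X φ)
  | k (φ ψ : Formula) : Provable T (φ.imp (ψ.imp φ))
  | s (φ ψ χ : Formula) :
      Provable T ((φ.imp (ψ.imp χ)).imp ((φ.imp ψ).imp (φ.imp χ)))
  | dne (φ : Formula) : Provable T (φ.neg.neg.imp φ)
  | inst (φ : Formula) (x : ℕ) (u : Term) : φ.FreeFor x u →
      Provable T ((Formula.all x φ).imp (φ.subst x u))
  | instS (φ : Formula) (X U : ℕ) : φ.FreeForS X U →
      Provable T ((Formula.allS X φ).imp (φ.substS X U))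
  | dist (φ ψ : Formula) (x : ℕ) : ¬ φ.Free x →
      Provable T ((Formula.all x (φ.imp ψ)).imp (φ.imp (.all x ψ)))
  | distS (φ ψ : Formula) (X : ℕ) : ¬ φ.FreeS X →
      Provable T ((Formula.allS X (φ.imp ψ)).imp (φ.imp (.allS X ψ)))
  | eqRefl (t : Term) : Provable T (.eq t t)
  | eqSubst (φ : Formula) (x : ℕ) (s t : Term) : φ.FreeFor x s → φ.FreeFor x t →
      Provable T ((Formula.eq s t).imp ((φ.subst x s).imp (φ.subst x t)))

/-! ### The theory `RCA₀` -/

/-- `Δ⁰₀` formulas, in which every quantifier is a bounded number quantifier `∀ x < t` or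
`∃ x < t` with `x` not occurring in `t`.  Set variables may occur as parameters. -/
inductive IsDelta00 : Formula → Prop
  | eq (s t : Term) : IsDelta00 (.eq s t)
  | lt (s t : Term) : IsDelta00 (.lt s t)
  | mem (t : Term) (X : ℕ) : IsDelta00 (.mem t X)
  | fls : IsDelta00 .fls
  | imp {φ ψ : Formula} : IsDelta00 φ → IsDelta00 ψ → IsDelta00 (φ.imp ψ)
  | allLt {φ : Formula} (x : ℕ) (t : Term) : ¬ t.Occurs x → IsDelta00 φ →
      IsDelta00 (.all x ((Formula.lt (.var x) t).imp φ))
  | exLt {φ : Formula} (x : ℕ) (t : Term) : ¬ t.Occurs x → IsDelta00 φ →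
      IsDelta00 (.ex x ((Formula.lt (.var x) t).and φ))

/-- `Σ⁰₁` formulas `∃ x θ`, with `θ` a `Δ⁰₀` formula. -/
def IsSigma01 (φ : Formula) : Prop := ∃ (x : ℕ) (θ : Formula), IsDelta00 θ ∧ φ = .ex x θ

/-- `Π⁰₁` formulas `∀ x θ`, with `θ` a `Δ⁰₀` formula. -/
def IsPi01 (φ : Formula) : Prop := ∃ (x : ℕ) (θ : Formula), IsDelta00 θ ∧ φ = .all x θ

/-- The theory `RCA₀`: the basic arithmetic of `0, 1, +, ·, <`, the scheme of `Σ⁰₁` induction and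
the scheme of `Δ⁰₁` comprehension, where the formulas in the schemes may have number and set
parameters. -/
inductive RCA0 : Set Formula
  | succ_ne_zero (m : Term) : RCA0 (Formula.eq (m.add .one) .zero).neg
  | succ_inj (m n : Term) :
      RCA0 ((Formula.eq (m.add .one) (n.add .one)).imp (.eq m n))
  | add_zero (m : Term) : RCA0 (.eq (m.add .zero) m)
  | add_succ (m n : Term) : RCA0 (.eq (m.add (n.add .one)) ((m.add n).add .one))
  | mul_zero (m : Term) : RCA0 (.eq (m.mul .zero) .zero)
  | mul_succ (m n : Term) : RCA0 (.eq (m.mul (n.add .one)) ((m.mul n).add m))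
  | not_lt_zero (m : Term) : RCA0 (Formula.lt m .zero).neg
  | lt_succ (m n : Term) :
      RCA0 ((Formula.lt m (n.add .one)).iff ((Formula.lt m n).or (.eq m n)))
  | induction (φ : Formula) (n : ℕ) : IsSigma01 φ →
      RCA0 (((φ.subst n .zero).and
        (.all n (φ.imp (φ.subst n ((Term.var n).add .one))))).imp (.all n φ))
  | comprehension (φ ψ : Formula) (n X : ℕ) : IsSigma01 φ → IsPi01 ψ → ¬ φ.FreeS X →
      RCA0 ((Formula.all n (φ.iff ψ)).imp
        (.exS X (.all n ((Formula.mem (.var n) X).iff φ))))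

/-! ### `ω`-models -/

/-- The value of a term in the standard natural numbers. -/
def Term.val (e : ℕ → ℕ) : Term → ℕ
  | .var x => e x
  | .zero => 0
  | .one => 1
  | .add s t => s.val e + t.val e
  | .mul s t => s.val e * t.val e

/-- Satisfaction in the `ω`-model whose numbers are the standard natural numbers and whose sets
are the members of `S`, under an assignment `e` of numbers and `E` of sets. -/
def Sat (S : Set (Set ℕ)) : (ℕ → ℕ) → (ℕ → S) → Formula → Prop
  | e, _, .eq s t => s.val e = t.val e
  | e, _, .lt s t => s.val e < t.val e
  | e, E, .mem t X => t.val e ∈ (E X : Set ℕ)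
  | _, _, .fls => False
  | e, E, .imp φ ψ => Sat S e E φ → Sat S e E ψ
  | e, E, .all x φ => ∀ a : ℕ, Sat S (Function.update e x a) E φ
  | e, E, .allS X φ => ∀ A : S, Sat S e (Function.update E X A) φ

/-- The formula `φ` (or rather its universal closure) is true in the `ω`-model given by `S`. -/
def Models (S : Set (Set ℕ)) (φ : Formula) : Prop :=
  ∀ (e : ℕ → ℕ) (E : ℕ → S), Sat S e E φ

/-- The computable sets of natural numbers, i.e. the `ω`-model `REC`. -/
def REC : Set (Set ℕ) := {X | ComputablePred fun n : ℕ => n ∈ X}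

/-! ### Partial orders in the language of second order arithmetic

A partial order is given by set variables `P` and `R`, with `R ⊆ P × P` coded through the pairing
`(s, t) = (s + t)² + s`.  The arguments `P`, `R`, `I`, `D` below are names of set variables; they
are always instantiated by `0`, `1`, `2`, `4`, and the set variable `3` is used for the sequence of
ideals. -/

/-- `∀ k, f k`, for a number variable `k`. -/
def forallN (k : ℕ) (f : Term → Formula) : Formula := .all k (f (.var k))

/-- `∃ k, f k`, for a number variable `k`. -/
def existsN (k : ℕ) (f : Term → Formula) : Formula := .ex k (f (.var k))

/-- The pairing term `(s, t) = (s + t)² + s`. -/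
def pairT (s t : Term) : Term := ((s.add t).mul (s.add t)).add s

/-- `s ⪯ t`, i.e. `(s, t) ∈ R`. -/
def leF (R : ℕ) (s t : Term) : Formula := .mem (pairT s t) R

/-- `(P, R)` is a partial order: `R ⊆ P × P` is reflexive on `P`, antisymmetric, transitive. -/
def partialOrderF (P R : ℕ) : Formula :=
  (forallN 2 fun z => (Formula.mem z R).imp <| existsN 0 fun x => existsN 1 fun y =>
    (Formula.mem x P).and ((Formula.mem y P).and (.eq z (pairT x y)))).and <|
  (forallN 0 fun x => (Formula.mem x P).imp (leF R x x)).and <|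
  (forallN 0 fun x => forallN 1 fun y => ((leF R x y).and (leF R y x)).imp (.eq x y)).and <|
  forallN 0 fun x => forallN 1 fun y => forallN 2 fun z =>
    ((leF R x y).and (leF R y z)).imp (leF R x z)

/-- The class `U` is an initial interval of `P`. -/
def initialIntervalF (P R : ℕ) (U : Term → Formula) : Formula :=
  (forallN 0 fun x => (U x).imp (.mem x P)).and <|
  forallN 0 fun x => forallN 1 fun y =>
    ((Formula.mem x P).and ((Formula.mem y P).and ((leF R x y).and (U y)))).imp (U x)

/-- The class `U` is an ideal of `P`: an initial interval any two elements of which have an upper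
bound in `U`. -/
def idealF (P R : ℕ) (U : Term → Formula) : Formula :=
  (initialIntervalF P R U).and <|
  forallN 0 fun x => forallN 1 fun y => ((U x).and (U y)).imp <|
    existsN 2 fun z => (U z).and ((leF R x z).and (leF R y z))

/-- `I` is a finite union of ideals of `P`: there are a (set coding a) sequence of sets
`Aᵢ = {x : (x, i) ∈ A}` and a number `n` such that `Aᵢ` is an ideal for all `i < n`, and
`I = ⋃_{i < n} Aᵢ`. -/
def finiteUnionOfIdealsF (P R I : ℕ) : Formula :=
  .exS 3 <| existsN 4 fun n =>
    (forallN 3 fun i => (Formula.lt i n).imp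
      (idealF P R fun x => .mem (pairT x i) 3)).and <|
    forallN 0 fun x => (Formula.mem x I).iff
      (existsN 3 fun i => (Formula.lt i n).and (.mem (pairT x i) 3))

/-- All initial intervals of `P` are finite unions of ideals. -/
def allIntervalsFiniteUnionF (P R : ℕ) : Formula :=
  .allS 2 <| (initialIntervalF P R fun x => .mem x 2).imp (finiteUnionOfIdealsF P R 2)

/-- `D ⊆ P` is an infinite (i.e. unbounded in the natural numbers) antichain. -/
def infiniteAntichainF (P R D : ℕ) : Formula :=
  (forallN 0 fun x => (Formula.mem x D).imp (.mem x P)).and <|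
  (forallN 0 fun x => forallN 1 fun y =>
    ((Formula.mem x D).and ((Formula.mem y D).and (Formula.eq x y).neg)).imp
      ((leF R x y).neg.and (leF R y x).neg)).and <|
  forallN 0 fun x => existsN 1 fun y => (Formula.lt x y).and (.mem y D)

/-- `P` has no infinite antichains. -/
def noInfiniteAntichainF (P R : ℕ) : Formula := (Formula.exS 4 (infiniteAntichainF P R 4)).neg

/-- The sentence: every partial order such that all its initial intervals are finite unions of
ideals has no infinite antichains. -/
def finiteUnionsImplyNoInfiniteAntichain : Formula :=
  .allS 0 <| .allS 1 <| (partialOrderF 0 1).imp <|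
    (allIntervalsFiniteUnionF 0 1).imp (noInfiniteAntichainF 0 1)

/-! ### The corresponding notions for actual sets of natural numbers -/

/-- `x ⪯ y` in the relation coded by `R`. -/
def CodedLe (R : Set ℕ) (x y : ℕ) : Prop := (x + y) * (x + y) + x ∈ R

/-- `(P, R)` is a partial order: `R` codes a subset of `P × P` which is reflexive on `P`,
antisymmetric and transitive. -/
structure IsCodedPartialOrder (P R : Set ℕ) : Prop where
  subset : ∀ c ∈ R, ∃ x ∈ P, ∃ y ∈ P, c = (x + y) * (x + y) + x
  refl : ∀ x ∈ P, CodedLe R x x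
  antisymm : ∀ x y, CodedLe R x y → CodedLe R y x → x = y
  trans : ∀ x y z, CodedLe R x y → CodedLe R y z → CodedLe R x z

/-- `I` is an initial interval of `(P, R)`. -/
def IsInitialInterval (P R I : Set ℕ) : Prop :=
  I ⊆ P ∧ ∀ x ∈ P, ∀ y ∈ P, CodedLe R x y → y ∈ I → x ∈ I

/-- The downward closure in `(P, R)` of `F ⊆ P`. -/
def downClosure (P R F : Set ℕ) : Set ℕ := {x ∈ P | ∃ y ∈ F, CodedLe R x y}

end SecondOrderArith

namespace SecondOrderArith

open Function

/-! By soundness (`Provable.models`) it suffices that `REC` satisfies `RCA0` and refutes the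
sentence. The first is `models_REC_of_mem_RCA0`: induction is automatic over the standard numbers,
and a Δ⁰₁ set with computable parameters is computable because it and its complement are both r.e.

The counterexample is an order on all of ℕ, built by finite injury. The witness `w` at height `e` of
the stack waits for the `e`-th partial computable function to converge at `w`. If the value is
nonzero, `w` is labelled `true` and every number arriving while it stays on the stack goes below
`w`; if the value is zero, the label is `false` and these numbers go above `w`. Labelling discards
all higher witnesses. Hence the stack below a surviving witness is the one it was pushed on
(`eq_stackAt_of_suffix`), and this coherence makes the relation transitive.

Each witness is labelled at most once, so every height stabilizes (`exists_stable`). Let `I` be a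
computable initial interval and `w` the final witness for its characteristic function
(`exists_witness`). If `w ∈ I`, almost all numbers lie below `w`, so `I` is generated by `w` and
finitely many other elements; if `w ∉ I`, almost all numbers lie above `w`, so `I` is finite
(`exists_finite_generators`). A finitely generated interval is a finite union of principal ideals.
Only even numbers become witnesses, and of two distinct comparable numbers one is a witness, so the
odd numbers form an infinite antichain. -/

theorem Term.val_congr {t : Term} {e e' : ℕ → ℕ} (h : ∀ x, t.Occurs x → e x = e' x) :
    t.val e = t.val e' := by
  induction t with
  | var y => exact h y rfl
  | zero => rfl
  | one => rfl
  | add s t ihs iht =>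
    simp only [Term.val, ihs fun x hx => h x (Or.inl hx), iht fun x hx => h x (Or.inr hx)]
  | mul s t ihs iht =>
    simp only [Term.val, ihs fun x hx => h x (Or.inl hx), iht fun x hx => h x (Or.inr hx)]

theorem Term.val_update_of_not_occurs {t : Term} {x : ℕ} (h : ¬ t.Occurs x) (e : ℕ → ℕ) (a : ℕ) :
    t.val (update e x a) = t.val e :=
  Term.val_congr fun y hy => update_of_ne (by rintro rfl; exact h hy) _ _

theorem Term.val_subst (x : ℕ) (u t : Term) (e : ℕ → ℕ) :
    (Term.subst x u t).val e = t.val (update e x (u.val e)) := by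
  induction t with
  | var y =>
    by_cases h : y = x
    · subst h; simp [Term.subst, Term.val]
    · simp [Term.subst, Term.val, h]
  | zero => rfl
  | one => rfl
  | add s t ihs iht => simp only [Term.subst, Term.val, ihs, iht]
  | mul s t ihs iht => simp only [Term.subst, Term.val, ihs, iht]

/-! ### Substitution lemmas and soundness for `ω`-models -/

section Sat

variable {S : Set (Set ℕ)}

@[simp] theorem sat_neg {e : ℕ → ℕ} {E : ℕ → S} {φ : Formula} :
    Sat S e E φ.neg ↔ ¬ Sat S e E φ := Iff.rfl

@[simp] theorem sat_and {e : ℕ → ℕ} {E : ℕ → S} {φ ψ : Formula} :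
    Sat S e E (φ.and ψ) ↔ Sat S e E φ ∧ Sat S e E ψ := by
  simp only [Formula.and, sat_neg, Sat]; tauto

@[simp] theorem sat_or {e : ℕ → ℕ} {E : ℕ → S} {φ ψ : Formula} :
    Sat S e E (φ.or ψ) ↔ Sat S e E φ ∨ Sat S e E ψ := by
  simp only [Formula.or, sat_neg, Sat]; tauto

@[simp] theorem sat_iff {e : ℕ → ℕ} {E : ℕ → S} {φ ψ : Formula} :
    Sat S e E (φ.iff ψ) ↔ (Sat S e E φ ↔ Sat S e E ψ) := by
  simp only [Formula.iff, sat_and, Sat]; tauto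

@[simp] theorem sat_ex {e : ℕ → ℕ} {E : ℕ → S} {x : ℕ} {φ : Formula} :
    Sat S e E (.ex x φ) ↔ ∃ a : ℕ, Sat S (update e x a) E φ := by
  simp only [Formula.ex, sat_neg, Sat, not_forall, not_not]

@[simp] theorem sat_exS {e : ℕ → ℕ} {E : ℕ → S} {X : ℕ} {φ : Formula} :
    Sat S e E (.exS X φ) ↔ ∃ A : S, Sat S e (update E X A) φ := by
  simp only [Formula.exS, sat_neg, Sat, not_forall, not_not]

/-- Satisfaction depends only on the values of the free variables. -/
theorem sat_congr {φ : Formula} {e e' : ℕ → ℕ} {E E' : ℕ → S}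
    (h : ∀ x, φ.Free x → e x = e' x) (H : ∀ X, φ.FreeS X → E X = E' X) :
    Sat S e E φ ↔ Sat S e' E' φ := by
  induction φ generalizing e e' E E' with
  | eq s t =>
    simp only [Sat, Term.val_congr fun x hx => h x (Or.inl hx),
      Term.val_congr fun x hx => h x (Or.inr hx)]
  | lt s t =>
    simp only [Sat, Term.val_congr fun x hx => h x (Or.inl hx),
      Term.val_congr fun x hx => h x (Or.inr hx)]
  | mem t X => simp only [Sat, Term.val_congr h, H X rfl]
  | fls => rfl
  | imp φ ψ ih1 ih2 =>
    simp only [Sat, ih1 (fun x hx => h x (Or.inl hx)) (fun x hx => H x (Or.inl hx)),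
      ih2 (fun x hx => h x (Or.inr hx)) (fun x hx => H x (Or.inr hx))]
  | all y φ ih =>
    refine forall_congr' fun a => ih (fun x hx => ?_) H
    by_cases hxy : y = x
    · subst hxy; simp
    · rw [update_of_ne (Ne.symm hxy), update_of_ne (Ne.symm hxy), h x ⟨hxy, hx⟩]
  | allS Y φ ih =>
    refine forall_congr' fun a => ih h (fun x hx => ?_)
    by_cases hxy : Y = x
    · subst hxy; simp
    · rw [update_of_ne (Ne.symm hxy), update_of_ne (Ne.symm hxy), H x ⟨hxy, hx⟩]

theorem sat_update_of_not_free {φ : Formula} {x : ℕ} (h : ¬ φ.Free x) (e : ℕ → ℕ) (E : ℕ → S)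
    (a : ℕ) : Sat S (update e x a) E φ ↔ Sat S e E φ :=
  sat_congr (fun y hy => update_of_ne (by rintro rfl; exact h hy) _ _) fun _ _ => rfl

theorem sat_updateS_of_not_free {φ : Formula} {X : ℕ} (h : ¬ φ.FreeS X) (e : ℕ → ℕ) (E : ℕ → S)
    (A : S) : Sat S e (update E X A) φ ↔ Sat S e E φ :=
  sat_congr (fun _ _ => rfl) fun y hy => update_of_ne (by rintro rfl; exact h hy) _ _

theorem Term.subst_of_not_occurs {x : ℕ} {t : Term} (u : Term) (h : ¬ t.Occurs x) :
    Term.subst x u t = t := by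
  induction t with
  | var y => exact if_neg h
  | zero => rfl
  | one => rfl
  | add s t ihs iht =>
    simp only [Term.Occurs, not_or] at h
    simp only [Term.subst, ihs h.1, iht h.2]
  | mul s t ihs iht =>
    simp only [Term.Occurs, not_or] at h
    simp only [Term.subst, ihs h.1, iht h.2]

theorem Formula.subst_of_not_free {x : ℕ} {φ : Formula} (u : Term) (h : ¬ φ.Free x) :
    φ.subst x u = φ := by
  induction φ with
  | eq s t =>
    simp only [Formula.Free, not_or] at h
    simp only [Formula.subst, Term.subst_of_not_occurs u h.1, Term.subst_of_not_occurs u h.2]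
  | lt s t =>
    simp only [Formula.Free, not_or] at h
    simp only [Formula.subst, Term.subst_of_not_occurs u h.1, Term.subst_of_not_occurs u h.2]
  | mem t X => simp only [Formula.subst, Term.subst_of_not_occurs u h]
  | fls => rfl
  | imp φ ψ ih1 ih2 =>
    simp only [Formula.Free, not_or] at h
    simp only [Formula.subst, ih1 h.1, ih2 h.2]
  | all y φ ih =>
    by_cases hy : y = x
    · simp only [Formula.subst, if_pos hy]
    · simp only [Formula.subst, if_neg hy, ih fun hf => h ⟨hy, hf⟩]
  | allS Y φ ih => simp only [Formula.subst, ih h]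

theorem Formula.substS_of_not_free {X : ℕ} {φ : Formula} (U : ℕ) (h : ¬ φ.FreeS X) :
    φ.substS X U = φ := by
  induction φ with
  | eq s t => rfl
  | lt s t => rfl
  | mem t Y => exact congrArg _ (if_neg h)
  | fls => rfl
  | imp φ ψ ih1 ih2 =>
    simp only [Formula.FreeS, not_or] at h
    simp only [Formula.substS, ih1 h.1, ih2 h.2]
  | all y φ ih => simp only [Formula.substS, ih h]
  | allS Y φ ih =>
    by_cases hy : Y = X
    · simp only [Formula.substS, if_pos hy]
    · simp only [Formula.substS, if_neg hy, ih fun hf => h ⟨hy, hf⟩]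

theorem sat_subst {x : ℕ} {u : Term} {φ : Formula} (hφ : φ.FreeFor x u) (e : ℕ → ℕ)
    (E : ℕ → S) : Sat S e E (φ.subst x u) ↔ Sat S (update e x (u.val e)) E φ := by
  induction φ generalizing e E with
  | eq s t => simp only [Formula.subst, Sat, Term.val_subst]
  | lt s t => simp only [Formula.subst, Sat, Term.val_subst]
  | mem t X => simp only [Formula.subst, Sat, Term.val_subst]
  | fls => rfl
  | imp φ ψ ih1 ih2 => simp only [Formula.subst, Sat, ih1 hφ.1, ih2 hφ.2]
  | all y φ ih =>
    -- Either `x` is not free in the quantified formula and substitution does nothing, or `u` avoids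
    -- the bound variable and its value survives the update at `y`.
    rcases hφ with h | ⟨hu, hf⟩
    · rw [Formula.subst_of_not_free u h, sat_update_of_not_free h]
    · by_cases hy : y = x
      · subst hy
        simp only [Formula.subst, if_true, Sat, update_idem]
      · simp only [Formula.subst, if_neg hy, Sat]
        refine forall_congr' fun a => ?_
        rw [ih hf, Term.val_update_of_not_occurs hu, update_comm hy]
  | allS Y φ ih => exact forall_congr' fun A => ih hφ _ _

theorem sat_substS {X U : ℕ} {φ : Formula} (hφ : φ.FreeForS X U) (e : ℕ → ℕ)
    (E : ℕ → S) : Sat S e E (φ.substS X U) ↔ Sat S e (update E X (E U)) φ := by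
  induction φ generalizing e E with
  | eq s t => rfl
  | lt s t => rfl
  | mem t Y =>
    by_cases hY : Y = X
    · subst hY; simp [Formula.substS, Sat]
    · simp [Formula.substS, Sat, hY]
  | fls => rfl
  | imp φ ψ ih1 ih2 => simp only [Formula.substS, Sat, ih1 hφ.1, ih2 hφ.2]
  | all y φ ih => exact forall_congr' fun a => ih hφ _ _
  | allS Y φ ih =>
    rcases hφ with h | ⟨hu, hf⟩
    · rw [Formula.substS_of_not_free U h, sat_updateS_of_not_free h]
    · by_cases hy : Y = X
      · subst hy
        simp only [Formula.substS, if_true, Sat, update_idem]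
      · simp only [Formula.substS, if_neg hy, Sat]
        refine forall_congr' fun A => ?_
        rw [ih hf, update_of_ne hu, update_comm hy]

/-- Soundness of the Hilbert calculus for `ω`-models. -/
theorem Provable.models {T : Set Formula} (hT : ∀ φ ∈ T, Models S φ) {φ : Formula}
    (h : Provable T φ) : Models S φ := by
  induction h with
  | hyp h => exact hT _ h
  | mp _ _ ih1 ih2 => exact fun e E => ih1 e E (ih2 e E)
  | gen x _ ih => exact fun e E a => ih _ E
  | genS X _ ih => exact fun e E A => ih e _
  | k φ ψ => exact fun e E h _ => h
  | s φ ψ χ => exact fun e E h1 h2 h3 => h1 h3 (h2 h3)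
  | dne φ => exact fun e E h => not_not.1 h
  | inst φ x u hf => exact fun e E h => (sat_subst hf e E).2 (h _)
  | instS φ X U hf => exact fun e E h => (sat_substS hf e E).2 (h _)
  | dist φ ψ x hf => exact fun e E h hφ a => h a ((sat_update_of_not_free hf e E a).2 hφ)
  | distS φ ψ X hf => exact fun e E h hφ A => h A ((sat_updateS_of_not_free hf e E A).2 hφ)
  | eqRefl t => exact fun e E => rfl
  | eqSubst φ x s t hs ht =>
    intro e E (h : s.val e = t.val e) hφ
    rw [sat_subst hs] at hφ
    rwa [sat_subst ht, ← h]

end Sat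

/-- Substituting for `x` a term in which at most `x` occurs captures no variable. -/
theorem Formula.freeFor_of_occurs {x : ℕ} {u : Term} (hu : ∀ y, u.Occurs y → y = x)
    (φ : Formula) : φ.FreeFor x u := by
  induction φ with
  | eq s t => trivial
  | lt s t => trivial
  | mem t X => trivial
  | fls => trivial
  | imp φ ψ ih1 ih2 => exact ⟨ih1, ih2⟩
  | all y φ ih =>
    by_cases hy : y = x
    · exact Or.inl fun h => h.1 hy
    · exact Or.inr ⟨fun h => hy (hu y h), ih⟩
  | allS Y φ ih => exact ih

end SecondOrderArith
namespace SecondOrderArith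

open Function

/-! ### Closure properties of computable and r.e. predicates -/

section Computability

variable {α : Type} [Primcodable α]

theorem computablePred_iff_exists {p : α → Prop} :
    ComputablePred p ↔ ∃ f : α → Bool, Computable f ∧ ∀ a, p a ↔ f a = true := by
  simp only [ComputablePred.computable_iff, funext_iff, eq_iff_iff]

theorem computablePred_comp {β : Type} [Primcodable β] {p : β → Prop} {f : α → β}
    (hp : ComputablePred p) (hf : Computable f) : ComputablePred fun a => p (f a) := by
  obtain ⟨g, hg, h⟩ := computablePred_iff_exists.1 hp
  exact computablePred_iff_exists.2 ⟨_, hg.comp hf, fun a => h _⟩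

theorem computablePred_imp {p q : α → Prop} (hp : ComputablePred p) (hq : ComputablePred q) :
    ComputablePred fun a => p a → q a := by
  obtain ⟨f, hf, h⟩ := computablePred_iff_exists.1 hp
  obtain ⟨g, hg, h'⟩ := computablePred_iff_exists.1 hq
  refine computablePred_iff_exists.2 ⟨fun a => !f a || g a,
    Primrec.or.to_comp.comp (Primrec.not.to_comp.comp hf) hg, fun a => ?_⟩
  rw [h, h', Bool.or_eq_true, Bool.not_eq_true', ← Bool.not_eq_true, imp_iff_not_or]

/-- Recursion on the bound accumulates the conjunction of the finitely many truth values. -/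
theorem computablePred_forall_lt {p : α × ℕ → Prop} (hp : ComputablePred p) {t : α → ℕ}
    (ht : Computable t) : ComputablePred fun a => ∀ b < t a, p (a, b) := by
  obtain ⟨f, hf, h⟩ := computablePred_iff_exists.1 hp
  have hr : Computable fun a =>
      (Nat.rec true (fun b r => r && f (a, b)) (t a) : Bool) :=
    Computable.nat_rec (h := fun a q => q.2 && f (a, q.1)) ht (Computable.const true)
      (Primrec.and.to_comp.comp (Computable.snd.comp Computable.snd)
        (hf.comp (Computable.pair Computable.fst (Computable.fst.comp Computable.snd)))).to₂
  refine computablePred_iff_exists.2 ⟨_, hr, fun a => ?_⟩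
  induction t a with
  | zero => simp
  | succ n ih => rw [Nat.forall_lt_succ_right, ih, Bool.and_eq_true, h]

theorem computablePred_exists_lt {p : α × ℕ → Prop} (hp : ComputablePred p) {t : α → ℕ}
    (ht : Computable t) : ComputablePred fun a => ∃ b < t a, p (a, b) :=
  (computablePred_forall_lt hp.not ht).not.of_eq fun a => by push Not; rfl

/-- An unbounded search for `b` halts exactly when a suitable `b` exists. -/
theorem rePred_exists {p : α × ℕ → Prop} (hp : ComputablePred p) :
    REPred fun a => ∃ b, p (a, b) := by
  obtain ⟨f, hf, h⟩ := computablePred_iff_exists.1 hp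
  have h1 : Partrec fun a => Nat.rfind fun b => Part.some (f (a, b)) :=
    Partrec.rfind (Computable.partrec hf)
  refine h1.dom_re.of_eq fun a => Nat.rfind_dom.trans ?_
  simp only [Part.mem_some_iff, Part.some_dom, h]
  exact ⟨fun ⟨n, hn, _⟩ => ⟨n, hn.symm⟩, fun ⟨n, hn⟩ => ⟨n, hn.symm, fun _ => trivial⟩⟩

end Computability

/-! ### `REC` as a model of `RCA0` -/

section RCA0

variable {α : Type} [Primcodable α]

theorem Term.computable_val (t : Term) {g : α → ℕ → ℕ} (hg : ∀ i, Computable fun a => g a i) :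
    Computable fun a => t.val (g a) := by
  induction t with
  | var x => exact hg x
  | zero => exact Computable.const 0
  | one => exact Computable.const 1
  | add s t ihs iht => exact Primrec.nat_add.to_comp.comp ihs iht
  | mul s t ihs iht => exact Primrec.nat_mul.to_comp.comp ihs iht

theorem computable_update {g : α → ℕ → ℕ} (hg : ∀ i, Computable fun a => g a i) (x i : ℕ) :
    Computable fun p : α × ℕ => update (g p.1) x p.2 i := by
  by_cases h : i = x
  · subst h; simpa using Computable.snd
  · simpa [h] using (hg i).comp Computable.fst

/-- The truth value in `REC` of a `Δ⁰₀` formula depends computably on the values of the number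
variables. -/
theorem IsDelta00.computablePred_sat {φ : Formula} (hφ : IsDelta00 φ) (E : ℕ → REC) :
    ∀ {α : Type} [Primcodable α] {g : α → ℕ → ℕ}, (∀ i, Computable fun a => g a i) →
      ComputablePred fun a => Sat REC (g a) E φ := by
  induction hφ with
  | eq s t =>
    intro α _ g hg
    exact computablePred_comp (Primrec.eq (α := ℕ)).computablePred
      ((s.computable_val hg).pair (t.computable_val hg))
  | lt s t =>
    intro α _ g hg
    exact computablePred_comp Primrec.nat_lt.computablePred
      ((s.computable_val hg).pair (t.computable_val hg))
  | mem t X =>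
    intro α _ g hg
    exact computablePred_comp (E X).2 (t.computable_val hg)
  | fls =>
    intro α _ g hg
    exact computablePred_iff_exists.2 ⟨fun _ => false, Computable.const _, fun a => by simp [Sat]⟩
  | imp _ _ ih1 ih2 =>
    intro α _ g hg
    exact computablePred_imp (ih1 hg) (ih2 hg)
  | allLt x t hx _ ih =>
    intro α _ g hg
    -- The induction hypothesis is applied over `α × ℕ`, the bound variable being the new
    -- coordinate; this is why the parameter type varies in the induction.
    refine (computablePred_forall_lt (ih (computable_update hg x)) (t.computable_val hg)).of_eq
      fun a => ?_
    simp only [Sat, Term.val, update_self, Term.val_update_of_not_occurs hx]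
  | exLt x t hx _ ih =>
    intro α _ g hg
    refine (computablePred_exists_lt (ih (computable_update hg x)) (t.computable_val hg)).of_eq
      fun a => ?_
    simp only [sat_ex, sat_and, Sat, Term.val, update_self, Term.val_update_of_not_occurs hx]

theorem IsSigma01.rePred_sat {φ : Formula} (hφ : IsSigma01 φ) (E : ℕ → REC) {g : α → ℕ → ℕ}
    (hg : ∀ i, Computable fun a => g a i) : REPred fun a => Sat REC (g a) E φ := by
  obtain ⟨x, θ, hθ, rfl⟩ := hφ
  exact (rePred_exists (hθ.computablePred_sat E (computable_update hg x))).of_eq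
    fun a => by simp only [sat_ex]

theorem IsPi01.rePred_not_sat {φ : Formula} (hφ : IsPi01 φ) (E : ℕ → REC) {g : α → ℕ → ℕ}
    (hg : ∀ i, Computable fun a => g a i) : REPred fun a => ¬ Sat REC (g a) E φ := by
  obtain ⟨x, θ, hθ, rfl⟩ := hφ
  refine (rePred_exists (hθ.computablePred_sat E (computable_update hg x)).not).of_eq fun a => ?_
  simp only [Sat, not_forall]

/-- The computable sets form an `ω`-model of `RCA₀`. -/
theorem models_REC_of_mem_RCA0 {φ : Formula} (h : φ ∈ RCA0) : Models REC φ := by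
  intro e E
  cases h with
  | succ_ne_zero m => simp [Sat, Term.val]
  | succ_inj m n => simp [Sat, Term.val]
  | add_zero m => simp [Sat, Term.val]
  | add_succ m n => simp [Sat, Term.val, add_assoc]
  | mul_zero m => simp [Sat, Term.val]
  | mul_succ m n => simp [Sat, Term.val, mul_add]
  | not_lt_zero m => simp [Sat, Term.val]
  | lt_succ m n => simp [Sat, Term.val, Nat.le_iff_lt_or_eq]
  | induction φ n _ =>
    simp only [Sat, sat_and]
    rw [sat_subst (Formula.freeFor_of_occurs (u := .zero) (fun y hy => False.elim hy) φ)]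
    rintro ⟨h0, hs⟩ a
    induction a with
    | zero => exact h0
    | succ a ih =>
      have := hs a ih
      rw [sat_subst (Formula.freeFor_of_occurs (u := (Term.var n).add .one)
        (fun y hy => Or.elim hy Eq.symm False.elim) φ)] at this
      simpa [Term.val] using this
  | comprehension φ ψ n X hφ hψ hX =>
    simp only [Sat, sat_exS, sat_iff, Term.val, update_self]
    intro h
    have hg : ∀ i, Computable fun a : ℕ => update e n a i := fun i =>
      (computable_update (g := fun _ : ℕ => e) (fun i => Computable.const (e i)) n i).comp
        (Computable.pair Computable.id Computable.id)
    -- Post's theorem: the Σ⁰₁ form enumerates the set, and the Π⁰₁ form enumerates its complement.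
    have hre := hφ.rePred_sat E hg
    have hco := (hψ.rePred_not_sat E hg).of_eq fun a => not_congr (h a).symm
    refine ⟨⟨{a | Sat REC (update e n a) E φ},
      ComputablePred.computable_iff_re_compl_re'.2 ⟨hre, hco⟩⟩,
      fun a => ?_⟩
    rw [sat_updateS_of_not_free hX]
    rfl

end RCA0

end SecondOrderArith
namespace SecondOrderArith

open Nat.Partrec (Code)

/-! ### A computable partial order built by a finite injury construction

At every stage there is a stack of witnesses, the newest one first.  The witness at height `e` is
meant to diagonalize against the `e`-th partial computable function: its label is `none` until that
function is seen to converge at the witness, and then records whether the value is nonzero. -/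

/-- A stack of labelled witnesses. -/
abbrev Stack : Type := List (ℕ × Option Bool)

/-- One step in scanning a stack upwards for a witness that requires attention at stage `c`; the
Boolean tells whether one has been found, in which case everything above it is discarded. -/
def scanStep (c : ℕ) (p : ℕ × Option Bool) (r : Bool × Stack) : Bool × Stack :=
  bif r.1 then r
  else p.2.casesOn
    ((Code.evaln c (Denumerable.ofNat Code r.2.length) p.1).casesOn (false, p :: r.2)
      fun v => (true, (p.1, some (!(v == 0))) :: r.2))
    fun _ => (false, p :: r.2)

/-- Scan a stack for the lowest witness that requires attention at stage `c`. -/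
def scan (c : ℕ) (s : Stack) : Bool × Stack := s.foldr (scanStep c) (false, [])

/-- The stack before stage `c`: at even stages `c` is pushed as a new witness, and at odd stages
the lowest witness that requires attention is labelled. -/
def stackAt (c : ℕ) : Stack :=
  Nat.rec [] (fun c s => bif c.bodd then (scan c s).2 else (c, none) :: s) c

/-- Convergence is only tested with the bounded evaluator `Code.evaln`, so each stage is primitive
recursive. -/
theorem primrec_scan : Primrec₂ scan := by
  have hr : Primrec fun q : (ℕ × Stack) × (ℕ × Option Bool) × (Bool × Stack) => q.2.2 :=
    Primrec.snd.comp Primrec.snd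
  have hp : Primrec fun q : (ℕ × Stack) × (ℕ × Option Bool) × (Bool × Stack) => q.2.1 :=
    Primrec.fst.comp Primrec.snd
  have hc : Primrec fun q : (ℕ × Stack) × (ℕ × Option Bool) × (Bool × Stack) => q.1.1 :=
    Primrec.fst.comp Primrec.fst
  have hskip : Primrec fun q : (ℕ × Stack) × (ℕ × Option Bool) × (Bool × Stack) =>
      (false, q.2.1 :: q.2.2.2) :=
    (Primrec.const false).pair (Primrec.list_cons.comp hp (Primrec.snd.comp hr))
  have hev : Primrec fun q : (ℕ × Stack) × (ℕ × Option Bool) × (Bool × Stack) =>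
      Code.evaln q.1.1 (Denumerable.ofNat Code q.2.2.2.length) q.2.1.1 :=
    Code.primrec_evaln.comp ((hc.pair ((Primrec.ofNat Code).comp
      (Primrec.list_length.comp (Primrec.snd.comp hr)))).pair (Primrec.fst.comp hp))
  have hact : Primrec₂ fun (q : (ℕ × Stack) × (ℕ × Option Bool) × (Bool × Stack)) (v : ℕ) =>
      (true, (q.2.1.1, some (!(v == 0))) :: q.2.2.2) :=
    ((Primrec.const true).pair (Primrec.list_cons.comp
      (((Primrec.fst.comp hp).comp Primrec.fst).pair (Primrec.option_some.comp
        (Primrec.not.comp (Primrec.beq.comp Primrec.snd (Primrec.const 0)))))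
      ((Primrec.snd.comp hr).comp Primrec.fst))).to₂
  exact (Primrec.list_foldr (h := fun q r => scanStep q.1 r.1 r.2) Primrec.snd
    (Primrec.const (false, [])) (Primrec.cond (Primrec.fst.comp hr) hr
      (Primrec.option_casesOn (Primrec.snd.comp hp)
        (Primrec.option_casesOn hev hskip hact) (hskip.comp Primrec.fst).to₂)).to₂).to₂

theorem primrec_stackAt : Primrec stackAt :=
  Primrec.nat_rec₁ _ (Primrec.cond (Primrec.nat_bodd.comp Primrec.fst)
    (Primrec.snd.comp (primrec_scan.comp Primrec.fst Primrec.snd))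
    (Primrec.list_cons.comp (Primrec.fst.pair (Primrec.const none)) Primrec.snd)).to₂

/-! ### Invariants of the stack -/

theorem stackAt_succ_of_even {c : ℕ} (h : c.bodd = false) :
    stackAt (c + 1) = (c, none) :: stackAt c := by
  change (bif c.bodd then _ else _) = _
  rw [h]; rfl

theorem stackAt_succ_of_odd {c : ℕ} (h : c.bodd = true) :
    stackAt (c + 1) = (scan c (stackAt c)).2 := by
  change (bif c.bodd then _ else _) = _
  rw [h]; rfl

/-- The scan either changes nothing, or it labels a witness with an observed value and discards
everything above. -/
theorem scan_cases (c : ℕ) (s : Stack) :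
    scan c s = (false, s) ∨ ∃ w l v, (w, none) :: l <:+ s ∧
      v ∈ Code.evaln c (Denumerable.ofNat Code l.length) w ∧
      scan c s = (true, (w, some (!(v == 0))) :: l) := by
  induction s with
  | nil => exact Or.inl rfl
  | cons p s ih =>
    have hs : scan c (p :: s) = scanStep c p (scan c s) := rfl
    rcases ih with h | ⟨w, l, v, hl, hv, h⟩
    · obtain ⟨w, b⟩ := p
      rw [h] at hs
      cases b with
      | some b => exact Or.inl hs
      | none =>
        cases hv : Code.evaln c (Denumerable.ofNat Code s.length) w with
        | none => left; rw [hs]; simp [scanStep, hv]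
        | some v =>
          exact Or.inr ⟨w, s, v, List.suffix_refl _, hv, by rw [hs]; simp [scanStep, hv]⟩
    · exact Or.inr ⟨w, l, v, hl.trans (List.suffix_cons _ _), hv, by rw [hs, h]; rfl⟩

/-- A witness that requires attention is labelled or discarded. -/
theorem not_suffix_scan {c w v : ℕ} {l s : Stack} (hs : (w, none) :: l <:+ s)
    (hv : v ∈ Code.evaln c (Denumerable.ofNat Code l.length) w) :
    ¬ (w, none) :: l <:+ (scan c s).2 := by
  -- The scan acts at this witness or lower, so the result is too short to contain the old suffix
  -- unless equal to it, and the labels at the top exclude equality.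
  have key : (scan c s).1 = true ∧ (scan c s).2.length ≤ l.length + 1 ∧
      (scan c s).2 ≠ (w, none) :: l := by
    obtain ⟨t, rfl⟩ := hs
    induction t with
    | nil =>
      have hs : scan c ((w, none) :: l) = scanStep c (w, none) (scan c l) := rfl
      rw [List.nil_append, hs]
      rcases scan_cases c l with h | ⟨w', l', v', hl', -, h⟩
      · rw [Option.mem_def] at hv
        simp [h, scanStep, hv]
      · have := hl'.length_le
        simp only [List.length_cons] at this
        simp only [h, scanStep, cond_true, List.length_cons, true_and]
        refine ⟨by omega, fun he => ?_⟩
        simp at he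
    | cons p t ih =>
      have hs : scan c (p :: t ++ (w, none) :: l) =
        scanStep c p (scan c (t ++ (w, none) :: l)) := rfl
      have : scanStep c p (scan c (t ++ (w, none) :: l)) = scan c (t ++ (w, none) :: l) := by
        simp [scanStep, ih.1]
      rwa [hs, this]
  intro h
  refine key.2.2 (h.eq_of_length_le ?_).symm
  simpa using key.2.1

/-- The possible changes of the stack at one stage. -/
theorem stackAt_succ_cases (c : ℕ) :
    stackAt (c + 1) = (c, none) :: stackAt c ∨ stackAt (c + 1) = stackAt c ∨
      ∃ w l v, (w, none) :: l <:+ stackAt c ∧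
        v ∈ Code.evaln c (Denumerable.ofNat Code l.length) w ∧
        stackAt (c + 1) = (w, some (!(v == 0))) :: l := by
  cases h : c.bodd with
  | false => exact Or.inl (stackAt_succ_of_even h)
  | true =>
    right
    rw [stackAt_succ_of_odd h]
    rcases scan_cases c (stackAt c) with h | ⟨w, l, v, hl, hv, h⟩
    · exact Or.inl (by rw [h])
    · exact Or.inr ⟨w, l, v, hl, hv, by rw [h]⟩

/-- Below a witness the stack is what it was when the witness was pushed. -/
theorem eq_stackAt_of_suffix {m n : ℕ} {b : Option Bool} {l : Stack}
    (h : (n, b) :: l <:+ stackAt m) : l = stackAt n := by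
  induction m generalizing n b l with
  | zero => simp [stackAt] at h
  | succ m ih =>
    rcases stackAt_succ_cases m with hm | hm | ⟨w, l', v, hl', -, hm⟩
    · rw [hm, List.suffix_cons_iff] at h
      rcases h with h | h
      · simp only [List.cons.injEq, Prod.mk.injEq] at h
        rw [h.2, h.1.1]
      · exact ih h
    · exact ih (hm ▸ h)
    · rw [hm, List.suffix_cons_iff] at h
      rcases h with h | h
      · simp only [List.cons.injEq, Prod.mk.injEq] at h
        rw [h.1.1, h.2]
        exact ih hl'
      · exact ih (h.trans ((List.suffix_cons _ _).trans hl'))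

theorem suffix_of_mem_stackAt {m n : ℕ} {b : Option Bool} (h : (n, b) ∈ stackAt m) :
    (n, b) :: stackAt n <:+ stackAt m := by
  obtain ⟨s, t, hst⟩ := List.append_of_mem h
  have hs : (n, b) :: t <:+ stackAt m := ⟨s, hst.symm⟩
  rwa [eq_stackAt_of_suffix hs] at hs

theorem lt_of_mem_stackAt {m n : ℕ} {b : Option Bool} (h : (n, b) ∈ stackAt m) : n < m := by
  induction m generalizing b with
  | zero => simp [stackAt] at h
  | succ m ih =>
    rcases stackAt_succ_cases m with hm | hm | ⟨w, l', v, hl', -, hm⟩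
    · rw [hm, List.mem_cons] at h
      rcases h with h | h
      · simp only [Prod.mk.injEq] at h; omega
      · exact (ih h).trans (Nat.lt_succ_self _)
    · exact (ih (hm ▸ h)).trans (Nat.lt_succ_self _)
    · rw [hm, List.mem_cons] at h
      rcases h with h | h
      · obtain ⟨rfl, -⟩ := Prod.mk.inj h
        exact (ih (hl'.subset List.mem_cons_self)).trans (Nat.lt_succ_self _)
      · exact (ih (hl'.subset (List.mem_cons_of_mem _ h))).trans (Nat.lt_succ_self _)

theorem label_unique {m n : ℕ} {b b' : Option Bool} (h : (n, b) ∈ stackAt m)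
    (h' : (n, b') ∈ stackAt m) : b = b' := by
  have := List.suffix_of_suffix_length_le (suffix_of_mem_stackAt h) (suffix_of_mem_stackAt h')
    (by simp)
  simpa using this.eq_of_length (by simp)

/-- As long as `n` stays on the stack, nothing beneath it has been touched since stage `n`: any
action there would have discarded `n`. -/
theorem mem_stackAt_iff_of_lt {k m n : ℕ} {b b' : Option Bool} (h : (n, b) ∈ stackAt m)
    (hk : k < n) : (k, b') ∈ stackAt m ↔ (k, b') ∈ stackAt n := by
  have hn := suffix_of_mem_stackAt h
  refine ⟨fun hm => ?_, fun hm => hn.subset (List.mem_cons_of_mem _ hm)⟩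
  rcases List.suffix_or_suffix_of_suffix (suffix_of_mem_stackAt hm) hn with h' | h'
  · have := h'.subset List.mem_cons_self
    rcases List.mem_cons.1 this with h1 | h1
    · simp only [Prod.mk.injEq] at h1; omega
    · exact h1
  · have := h'.subset List.mem_cons_self
    rcases List.mem_cons.1 this with h1 | h1
    · simp only [Prod.mk.injEq] at h1; omega
    · exact absurd (lt_of_mem_stackAt h1) (by omega)

/-- A label once given is kept as long as the witness is on the stack. -/
theorem exists_label_of_le {n s t : ℕ} {b : Option Bool} (hns : n < s) (hst : s ≤ t)
    (h : (n, b) ∈ stackAt t) : ∃ b', (n, b') ∈ stackAt s ∧ (b' ≠ none → b' = b) := by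
  induction t, hst using Nat.le_induction generalizing b with
  | base => exact ⟨b, h, fun _ => rfl⟩
  | succ t hst ih =>
    rcases stackAt_succ_cases t with hm | hm | ⟨w, l', v, hl', -, hm⟩
    · rw [hm, List.mem_cons] at h
      rcases h with h | h
      · simp only [Prod.mk.injEq] at h; omega
      · exact ih h
    · exact ih (hm ▸ h)
    · rw [hm, List.mem_cons] at h
      rcases h with h | h
      -- Only an unlabelled witness receives a label, so by induction it was unlabelled at stage `s`
      -- as well and the implication is vacuous.
      · obtain ⟨rfl, -⟩ := Prod.mk.inj h
        obtain ⟨b', hb', hb⟩ := ih (hl'.subset List.mem_cons_self)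
        exact ⟨b', hb', fun hne => absurd (hb hne) hne⟩
      · exact ih (hl'.subset (List.mem_cons_of_mem _ h))

/-- Labels never change, and a discarded witness never returns, since `n` can be pushed only at
stage `n`. -/
theorem not_mem_both {n s t : ℕ} (h : (n, some false) ∈ stackAt s)
    (h' : (n, some true) ∈ stackAt t) : False := by
  have key : ∀ {s t : ℕ} {a b : Bool}, s ≤ t → (n, some a) ∈ stackAt s →
      (n, some b) ∈ stackAt t → a = b := by
    intro s t a b hst ha hb
    obtain ⟨b', hb', hbb⟩ := exists_label_of_le (lt_of_mem_stackAt ha) hst hb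
    have := label_unique ha hb'
    rw [← this] at hbb
    simpa using hbb
  rcases le_total s t with hst | hst
  · exact Bool.noConfusion (key hst h h')
  · exact Bool.noConfusion (key hst h' h)

/-- The label of a witness records an observed value. -/
theorem exists_evaln_of_suffix {t w : ℕ} {v : Bool} {l : Stack}
    (h : (w, some v) :: l <:+ stackAt t) :
    ∃ k x, x ∈ Code.evaln k (Denumerable.ofNat Code l.length) w ∧ v = !(x == 0) := by
  induction t with
  | zero => simp [stackAt] at h
  | succ t ih =>
    rcases stackAt_succ_cases t with hm | hm | ⟨w, l', x, hl', hx, hm⟩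
    · rw [hm, List.suffix_cons_iff] at h
      rcases h with h | h
      · simp at h
      · exact ih h
    · exact ih (hm ▸ h)
    · rw [hm, List.suffix_cons_iff] at h
      rcases h with h | h
      · simp only [List.cons.injEq, Prod.mk.injEq, Option.some.injEq] at h
        obtain ⟨⟨rfl, rfl⟩, rfl⟩ := h
        exact ⟨t, x, hx, rfl⟩
      · exact ih (h.trans ((List.suffix_cons _ _).trans hl'))

/-! ### Stabilization of the stack -/

/-- If everything below a witness is never changed, then the witness is never discarded. -/
theorem exists_label_of_stable {l : Stack} {s w : ℕ} (hl : ∀ t ≥ s, l <:+ stackAt t)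
    {b : Option Bool} (hw : (w, b) :: l <:+ stackAt s) {t : ℕ} (ht : s ≤ t) :
    ∃ b', (w, b') :: l <:+ stackAt t ∧ (b ≠ none → b' = b) := by
  induction t, ht using Nat.le_induction with
  | base => exact ⟨b, hw, fun _ => rfl⟩
  | succ t ht ih =>
    obtain ⟨b', hb', hb⟩ := ih
    rcases stackAt_succ_cases t with hm | hm | ⟨w', l', x, hl', -, hm⟩
    · exact ⟨b', hm ▸ hb'.trans (List.suffix_cons _ _), hb⟩
    · exact ⟨b', hm ▸ hb', hb⟩
    · have hlt := hl (t + 1) (ht.trans (Nat.le_succ t))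
      rw [hm] at hlt
      -- An action inside `l` would change a label in `l`, contradicting its stability.
      have hne : ¬ (w', none) :: l' <:+ l := fun h => by
        have h1 := (h.length_le).antisymm (by simpa using hlt.length_le)
        have h2 := h.eq_of_length h1
        have h3 := hlt.eq_of_length (by simpa using h1.symm)
        rw [← h2] at h3
        simp at h3
      rw [hm]
      rcases List.suffix_or_suffix_of_suffix hl' hb' with h | h
      · rw [List.suffix_cons_iff] at h
        rcases h with h | h
        · simp only [List.cons.injEq, Prod.mk.injEq] at h
          obtain ⟨⟨rfl, rfl⟩, rfl⟩ := h
          refine ⟨_, List.suffix_refl _, fun hbn => absurd (hb hbn).symm hbn⟩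
        · exact absurd h hne
      · rw [List.suffix_cons_iff] at h
        rcases h with h | h
        · simp only [List.cons.injEq, Prod.mk.injEq] at h
          obtain ⟨⟨rfl, rfl⟩, rfl⟩ := h
          refine ⟨_, List.suffix_refl _, fun hbn => absurd (hb hbn).symm hbn⟩
        · exact ⟨b', h.trans (List.suffix_cons _ _), hb⟩

/-- Above a stable part of the stack, there is eventually a stable witness. -/
theorem exists_stable_cons {l : Stack} {s : ℕ} (hl : ∀ t ≥ s, l <:+ stackAt t) :
    ∃ s' w b, ∀ t ≥ s', (w, b) :: l <:+ stackAt t := by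
  obtain ⟨s₁, hs₁, w, b₁, hw⟩ : ∃ s₁ ≥ s, ∃ w b, (w, b) :: l <:+ stackAt s₁ := by
    -- An even stage after `s` pushes a witness, so something then sits on `l`: the new witness
    -- itself, or the lowest entry that was already above `l`.
    have hodd : (2 * s).bodd = false := by simp
    have hle := hl (2 * s) (by omega)
    have hs := stackAt_succ_of_even hodd
    obtain ⟨u, hu⟩ := hle
    refine ⟨2 * s + 1, by omega, ?_⟩
    rw [hs, ← hu]
    rcases List.eq_nil_or_concat u with rfl | ⟨u, ⟨w, b⟩, rfl⟩
    · exact ⟨_, _, List.suffix_refl _⟩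
    · exact ⟨w, b, (2 * s, none) :: u, by simp⟩
  have hl₁ : ∀ t ≥ s₁, l <:+ stackAt t := fun t ht => hl t (hs₁.trans ht)
  by_cases h : ∃ t ≥ s₁, ∃ v : Bool, (w, some v) :: l <:+ stackAt t
  · obtain ⟨t, ht, v, hv⟩ := h
    refine ⟨t, w, some v, fun t' ht' => ?_⟩
    obtain ⟨b', hb', hb⟩ := exists_label_of_stable (fun r hr => hl₁ r (ht.trans hr)) hv ht'
    rwa [hb (by simp)] at hb'
  · refine ⟨s₁, w, none, fun t ht => ?_⟩
    obtain ⟨b', hb', -⟩ := exists_label_of_stable hl₁ hw ht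
    cases b' with
    | none => exact hb'
    | some v => exact absurd ⟨t, ht, v, hb'⟩ h

theorem exists_stable (e : ℕ) : ∃ (l : Stack) (s : ℕ), l.length = e ∧ ∀ t ≥ s, l <:+ stackAt t := by
  induction e with
  | zero => exact ⟨[], 0, rfl, fun t _ => List.nil_suffix⟩
  | succ e ih =>
    obtain ⟨l, s, hle, hl⟩ := ih
    obtain ⟨s', w, b, h⟩ := exists_stable_cons hl
    exact ⟨_, s', by rw [List.length_cons, hle], h⟩

/-- For every computable set `I` there is a witness whose final label tells whether it belongs
to `I`. -/
theorem exists_witness {I : Set ℕ} (hI : I ∈ REC) :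
    ∃ (s w : ℕ) (v : Bool), (v = true ↔ w ∈ I) ∧ ∀ t ≥ s, (w, some v) ∈ stackAt t := by
  obtain ⟨f, hf, hfI⟩ := computablePred_iff_exists.1 hI
  -- Codes compute numerical functions, so the characteristic function is made 0-1 valued; the label
  -- "value nonzero" then recovers `f w`.
  have hf' : Computable fun n => (f n).toNat :=
    (Primrec.cond Primrec.id (Primrec.const 1) (Primrec.const 0)).to_comp.comp hf |>.of_eq
      fun n => by cases f n <;> rfl
  obtain ⟨c, hc⟩ := Code.exists_code.1 (Partrec.nat_iff.1 hf'.partrec)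
  have hval : ∀ k w x, x ∈ Code.evaln k c w → (!(x == 0)) = f w := by
    intro k w x hx
    have := Code.evaln_sound hx
    rw [hc] at this
    have hx' : x = (f w).toNat := by simpa using this
    rw [hx']
    cases f w <;> rfl
  obtain ⟨l, s₀, hle, hl⟩ := exists_stable (Encodable.encode c)
  obtain ⟨s, w, b, hw⟩ := exists_stable_cons hl
  have hcode : Denumerable.ofNat Code l.length = c := by rw [hle, Denumerable.ofNat_encode]
  cases b with
  | some v =>
    refine ⟨s, w, v, ?_, fun t ht => (hw t ht).subset List.mem_cons_self⟩
    obtain ⟨k, x, hx, rfl⟩ := exists_evaln_of_suffix (hw s le_rfl)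
    rw [hcode] at hx
    rw [hval k w x hx]
    exact (hfI w).symm
  | none =>
    exfalso
    have : (f w).toNat ∈ c.eval w := by rw [hc]; exact Part.mem_some _
    obtain ⟨k, hk⟩ := Code.evaln_complete.1 this
    -- An odd stage past both `s` and `k`: the scan runs, the computation has converged, and the
    -- supposedly permanent unlabelled witness is lost.
    set t := 2 * (s + k) + 1 with ht
    have hodd : t.bodd = true := by simp [ht]
    have h1 := hw (t + 1) (by omega)
    rw [stackAt_succ_of_odd hodd] at h1
    refine not_suffix_scan (v := (f w).toNat) (hw t (by omega)) ?_ h1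
    rw [hcode]
    exact Code.evaln_mono (by omega) hk

/-! ### The partial order -/

/-- The order: later elements are placed above the witnesses labelled `false` and below those
labelled `true`. -/
def stackLE (a b : ℕ) : Prop :=
  a = b ∨ (a, some false) ∈ stackAt b ∨ (b, some true) ∈ stackAt a

theorem stackLE_antisymm {a b : ℕ} (hab : stackLE a b) (hba : stackLE b a) : a = b := by
  rcases hab with h | h | h
  · exact h
  · rcases hba with h' | h' | h'
    · exact h'.symm
    · have := lt_of_mem_stackAt h; have := lt_of_mem_stackAt h'; omega
    · exact (not_mem_both h h').elim
  · rcases hba with h' | h' | h'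
    · exact h'.symm
    · exact (not_mem_both h' h).elim
    · have := lt_of_mem_stackAt h; have := lt_of_mem_stackAt h'; omega

/-- When two witnesses occur on one stack, the older one is already on the stack of the newer one
with the same label; this transfers the comparison. A middle element with both labels is impossible.
-/
theorem stackLE_trans {a b c : ℕ} (hab : stackLE a b) (hbc : stackLE b c) : stackLE a c := by
  rcases hab with rfl | h | h
  · exact hbc
  · rcases hbc with rfl | h' | h'
    · exact Or.inr (Or.inl h)
    · exact Or.inr (Or.inl ((mem_stackAt_iff_of_lt h' (lt_of_mem_stackAt h)).2 h))
    · rcases lt_trichotomy a c with hac | rfl | hac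
      · exact Or.inr (Or.inl ((mem_stackAt_iff_of_lt h' hac).1 h))
      · exact (not_mem_both h h').elim
      · exact Or.inr (Or.inr ((mem_stackAt_iff_of_lt h hac).1 h'))
  · rcases hbc with rfl | h' | h'
    · exact Or.inr (Or.inr h)
    · exact (not_mem_both h' h).elim
    · exact Or.inr (Or.inr ((mem_stackAt_iff_of_lt h (lt_of_mem_stackAt h')).2 h'))

theorem even_of_mem_stackAt {m n : ℕ} {b : Option Bool} (h : (n, b) ∈ stackAt m) :
    n.bodd = false := by
  induction m generalizing b with
  | zero => simp [stackAt] at h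
  | succ m ih =>
    cases hm : m.bodd with
    | false =>
      rw [stackAt_succ_of_even hm, List.mem_cons] at h
      rcases h with h | h
      · simp only [Prod.mk.injEq] at h; rwa [h.1]
      · exact ih h
    | true =>
      rw [stackAt_succ_of_odd hm] at h
      rcases scan_cases m (stackAt m) with hs | ⟨w, l, v, hl, -, hs⟩
      · rw [hs] at h; exact ih h
      · rw [hs, List.mem_cons] at h
        rcases h with h | h
        · obtain ⟨rfl, -⟩ := Prod.mk.inj h
          exact ih (hl.subset List.mem_cons_self)
        · exact ih (hl.subset (List.mem_cons_of_mem _ h))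

/-- The odd numbers are pairwise incomparable. -/
theorem eq_of_stackLE_of_odd {a b : ℕ} (ha : a.bodd = true) (hb : b.bodd = true)
    (h : stackLE a b) : a = b := by
  rcases h with h | h | h
  · exact h
  · simp [even_of_mem_stackAt h] at ha
  · simp [even_of_mem_stackAt h] at hb

theorem primrecPred_mem_list {α β : Type} [Primcodable α] [Primcodable β] {f : β → α}
    {g : β → List α} (hf : Primrec f) (hg : Primrec g) : PrimrecPred fun x => f x ∈ g x :=
  (PrimrecRel.comp (PrimrecRel.exists_mem_list Primrec.eq) hg hf).of_eq fun x => by simp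

theorem primrecRel_stackLE : PrimrecRel stackLE := by
  have h1 : PrimrecRel fun a b : ℕ => (a, some false) ∈ stackAt b :=
    primrecPred_mem_list (Primrec.fst.pair (Primrec.const _)) (primrec_stackAt.comp Primrec.snd)
  have h2 : PrimrecRel fun a b : ℕ => (b, some true) ∈ stackAt a :=
    primrecPred_mem_list (Primrec.snd.pair (Primrec.const _)) (primrec_stackAt.comp Primrec.fst)
  exact PrimrecPred.or Primrec.eq (h1.or h2)

/-- A computable initial segment of the order is generated by finitely many elements. -/
theorem exists_finite_generators {I : Set ℕ} (hI : I ∈ REC)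
    (hdown : ∀ x y, stackLE x y → y ∈ I → x ∈ I) :
    ∃ F : Set ℕ, F.Finite ∧ I = {x | ∃ y ∈ F, stackLE x y} := by
  obtain ⟨s, w, v, hv, hw⟩ := exists_witness hI
  have key : ∀ F : Set ℕ, F ⊆ I → (∀ x ∈ I, ∃ y ∈ F, stackLE x y) →
      I = {x | ∃ y ∈ F, stackLE x y} := fun F hF h =>
    Set.Subset.antisymm h fun x ⟨y, hy, hxy⟩ => hdown x y hxy (hF hy)
  cases v with
  | true =>
    -- From stage `s` on every number lies below `w`, so only elements smaller than `s` need to be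
    -- added as generators.
    refine ⟨insert w (I ∩ Set.Iio s), ((Set.finite_Iio s).inter_of_right I).insert w, key _ ?_ ?_⟩
    · exact Set.insert_subset (hv.1 rfl) Set.inter_subset_left
    · intro x hx
      by_cases hxs : x < s
      · exact ⟨x, Or.inr ⟨hx, hxs⟩, Or.inl rfl⟩
      · exact ⟨w, Or.inl rfl, Or.inr (Or.inr (hw x (not_lt.1 hxs)))⟩
  | false =>
    -- An element of `I` not smaller than `s` would lie above `w` and force `w ∈ I`; thus `I` is
    -- finite and generates itself.
    refine ⟨I, (Set.finite_Iio s).subset fun x hx => ?_,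
      key _ subset_rfl fun x hx => ⟨x, hx, Or.inl rfl⟩⟩
    by_contra hxs
    have := hdown w x (Or.inr (Or.inl (hw x (not_lt.1 hxs)))) hx
    exact Bool.noConfusion (hv.2 this)

end SecondOrderArith
namespace SecondOrderArith

open Function

/-! ### Coding of pairs -/

theorem sqrt_pair (x y : ℕ) : Nat.sqrt ((x + y) * (x + y) + x) = x + y :=
  Nat.sqrt_add_eq _ (by omega)

theorem pair_injective {x y x' y' : ℕ}
    (h : (x + y) * (x + y) + x = (x' + y') * (x' + y') + x') : x = x' ∧ y = y' := by
  have hs : x + y = x' + y' := by rw [← sqrt_pair x y, h, sqrt_pair]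
  rw [hs] at h
  omega

/-- The set of codes of pairs in the relation `r`. -/
def codedSet (r : ℕ → ℕ → Prop) : Set ℕ := {c | ∃ x y, c = (x + y) * (x + y) + x ∧ r x y}

theorem pair_mem_codedSet {r : ℕ → ℕ → Prop} {x y : ℕ} :
    (x + y) * (x + y) + x ∈ codedSet r ↔ r x y := by
  refine ⟨fun ⟨x', y', h, hr⟩ => ?_, fun h => ⟨x, y, rfl, h⟩⟩
  obtain ⟨rfl, rfl⟩ := pair_injective h
  exact hr

/-- Decoding: `c.sqrt` is the sum of the coordinates and the remainder is the first one. Not every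
number is a code, hence the test that the remainder is at most the root. -/
theorem codedSet_mem_REC {r : ℕ → ℕ → Prop} (hr : PrimrecRel r) : codedSet r ∈ REC := by
  have hx : Primrec fun c : ℕ => c - c.sqrt * c.sqrt :=
    Primrec.nat_sub.comp Primrec.id (Primrec.nat_mul.comp Primrec.nat_sqrt Primrec.nat_sqrt)
  have hy : Primrec fun c : ℕ => c.sqrt - (c - c.sqrt * c.sqrt) :=
    Primrec.nat_sub.comp Primrec.nat_sqrt hx
  have h : PrimrecPred fun c : ℕ => c - c.sqrt * c.sqrt ≤ c.sqrt ∧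
      r (c - c.sqrt * c.sqrt) (c.sqrt - (c - c.sqrt * c.sqrt)) :=
    (PrimrecRel.comp Primrec.nat_le hx Primrec.nat_sqrt).and (hr.comp hx hy)
  refine h.computablePred.of_eq fun c => ⟨fun ⟨hle, hc⟩ => ⟨_, _, ?_, hc⟩, ?_⟩
  · rw [Nat.add_sub_cancel' hle]
    have := Nat.sqrt_le c
    omega
  · rintro ⟨x, y, rfl, hxy⟩
    rw [sqrt_pair, Nat.add_sub_cancel_left, Nat.add_sub_cancel_left]
    exact ⟨Nat.le_add_right _ _, hxy⟩

/-! ### The meaning of the formulas -/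

section Sat

variable {S : Set (Set ℕ)} {e : ℕ → ℕ} {E : ℕ → S}

theorem sat_partialOrderF :
    Sat S e E (partialOrderF 0 1) ↔ IsCodedPartialOrder (E 0) (E 1) := by
  have : IsCodedPartialOrder (E 0) (E 1) ↔
      (∀ c ∈ (E 1 : Set ℕ), ∃ x ∈ (E 0 : Set ℕ), ∃ y ∈ (E 0 : Set ℕ),
        c = (x + y) * (x + y) + x) ∧
      (∀ x ∈ (E 0 : Set ℕ), CodedLe (E 1) x x) ∧
      (∀ x y, CodedLe (E 1) x y → CodedLe (E 1) y x → x = y) ∧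
      ∀ x y z, CodedLe (E 1) x y → CodedLe (E 1) y z → CodedLe (E 1) x z :=
    ⟨fun h => ⟨h.1, h.2, h.3, h.4⟩, fun h => ⟨h.1, h.2.1, h.2.2.1, h.2.2.2⟩⟩
  rw [this]
  simp [partialOrderF, forallN, existsN, leF, pairT, Sat, Term.val, CodedLe]

theorem isInitialInterval_iff {P R I : Set ℕ} : IsInitialInterval P R I ↔
    (∀ x, x ∈ I → x ∈ P) ∧ ∀ x y, x ∈ P → y ∈ P → CodedLe R x y → y ∈ I → x ∈ I :=
  ⟨fun h => ⟨h.1, fun x y hx hy => h.2 x hx y hy⟩, fun h => ⟨h.1, fun x hx y hy => h.2 x y hx hy⟩⟩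

theorem sat_allIntervalsFiniteUnionF :
    Sat S e E (allIntervalsFiniteUnionF 0 1) ↔
      ∀ I : S, IsInitialInterval (E 0) (E 1) I → ∃ (A : S) (n : ℕ),
        (∀ i < n, IsInitialInterval (E 0) (E 1) {x | (x + i) * (x + i) + x ∈ (A : Set ℕ)} ∧
          ∀ x y, (x + i) * (x + i) + x ∈ (A : Set ℕ) → (y + i) * (y + i) + y ∈ (A : Set ℕ) →
            ∃ z, (z + i) * (z + i) + z ∈ (A : Set ℕ) ∧ CodedLe (E 1) x z ∧ CodedLe (E 1) y z) ∧
        ∀ x, x ∈ (I : Set ℕ) ↔ ∃ i < n, (x + i) * (x + i) + x ∈ (A : Set ℕ) := by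
  simp [allIntervalsFiniteUnionF, finiteUnionOfIdealsF, idealF, initialIntervalF, forallN, existsN,
    leF, pairT, Sat, Term.val, CodedLe, isInitialInterval_iff, -Subtype.forall, -Subtype.exists]

theorem sat_noInfiniteAntichainF :
    Sat S e E (noInfiniteAntichainF 0 1) ↔ ¬ ∃ D : S, (∀ x ∈ (D : Set ℕ), x ∈ (E 0 : Set ℕ)) ∧
      (∀ x y, x ∈ (D : Set ℕ) → y ∈ (D : Set ℕ) → x ≠ y →
        ¬ CodedLe (E 1) x y ∧ ¬ CodedLe (E 1) y x) ∧
      ∀ x, ∃ y, x < y ∧ y ∈ (D : Set ℕ) := by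
  simp [noInfiniteAntichainF, infiniteAntichainF, forallN, existsN,
    leF, pairT, Sat, Term.val, CodedLe]

end Sat

/-- In `REC`, the downward closures of finite sets are finite unions of ideals. -/
theorem sat_allIntervalsFiniteUnionF_of_downClosure {r : ℕ → ℕ → Prop} (hr : PrimrecRel r)
    (hrefl : ∀ x, r x x) (htrans : ∀ x y z, r x y → r y z → r x z)
    (hfin : ∀ I ∈ REC, (∀ x y, r x y → y ∈ I → x ∈ I) →
      ∃ F : Set ℕ, F.Finite ∧ I = {x | ∃ y ∈ F, r x y})
    {e : ℕ → ℕ} {E : ℕ → REC} (h0 : (E 0 : Set ℕ) = Set.univ) (h1 : (E 1 : Set ℕ) = codedSet r) :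
    Sat REC e E (allIntervalsFiniteUnionF 0 1) := by
  rw [sat_allIntervalsFiniteUnionF, h0, h1]
  simp only [IsInitialInterval, CodedLe, pair_mem_codedSet]
  rintro ⟨I, hI⟩ ⟨-, hdown⟩
  obtain ⟨F, hF, rfl⟩ := hfin I hI fun x y => hdown x trivial y trivial
  set L := hF.toFinset.toList with hL
  -- The `i`-th set is the principal ideal below the `i`-th generator, which itself serves as upper
  -- bound. The default 0 is never used because `i < L.length` is required.
  have hr' : PrimrecRel fun x i : ℕ => i < L.length ∧ r x (L.getD i 0) :=
    (PrimrecRel.comp Primrec.nat_lt Primrec.snd (Primrec.const _)).and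
      (hr.comp Primrec.fst ((Primrec.list_getD 0).comp (Primrec.const L) Primrec.snd))
  refine ⟨⟨codedSet _, codedSet_mem_REC hr'⟩, L.length, ?_, fun x => ?_⟩
  · intro i hi
    simp only [pair_mem_codedSet, Set.mem_ofPred_eq]
    refine ⟨⟨Set.subset_univ _, fun x _ y _ hxy hy => ⟨hi, htrans _ _ _ hxy hy.2⟩⟩,
      fun x y hx hy => ⟨_, ⟨hi, hrefl _⟩, hx.2, hy.2⟩⟩
  · simp only [pair_mem_codedSet, Set.mem_ofPred_eq]
    constructor
    · rintro ⟨y, hy, hxy⟩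
      obtain ⟨i, hi, rfl⟩ := List.getElem_of_mem (l := L) (by simpa [hL] using hy)
      exact ⟨i, hi, hi, by rwa [List.getD_eq_getElem _ _ hi]⟩
    · rintro ⟨i, hi, -, hxy⟩
      rw [List.getD_eq_getElem _ _ hi] at hxy
      have hmem : L[i] ∈ L := List.getElem_mem hi
      exact ⟨L[i], by simpa only [hL, Finset.mem_toList, Set.Finite.mem_toFinset] using hmem, hxy⟩

/-! ### Failure of the sentence in `REC` -/

theorem univ_mem_REC : (Set.univ : Set ℕ) ∈ REC :=
  computablePred_iff_exists.2 ⟨fun _ => true, Computable.const _, fun a => by simp⟩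

theorem odd_mem_REC : {n : ℕ | n.bodd = true} ∈ REC :=
  computablePred_iff_exists.2 ⟨Nat.bodd, Primrec.nat_bodd.to_comp, fun _ => Iff.rfl⟩

/-- The order on `ℕ` given by `stackLE` has the required properties in `REC`. -/
theorem exists_counterexample : ∃ P R : REC,
    IsCodedPartialOrder P R ∧
    (∃ D ∈ REC, D ⊆ P ∧ D.Infinite ∧ IsAntichain (CodedLe R) D) ∧
    (∀ I ∈ REC, IsInitialInterval P R I →
      ∃ F : Set ℕ, F.Finite ∧ F ⊆ P ∧ I = downClosure P R F) ∧
    ∀ (e : ℕ → ℕ) (E : ℕ → REC), E 0 = P → E 1 = R →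
      Sat REC e E (partialOrderF 0 1) ∧
      Sat REC e E (allIntervalsFiniteUnionF 0 1) ∧
      ¬ Sat REC e E (noInfiniteAntichainF 0 1) := by
  have hle : ∀ x y, CodedLe (codedSet stackLE) x y ↔ stackLE x y := fun x y => pair_mem_codedSet
  have hpo : IsCodedPartialOrder Set.univ (codedSet stackLE) :=
    { subset := fun c ⟨x, y, hc, _⟩ => ⟨x, trivial, y, trivial, hc⟩
      refl := fun x _ => (hle x x).2 (Or.inl rfl)
      antisymm := fun x y => by simpa only [hle] using stackLE_antisymm
      trans := fun x y z => by simpa only [hle] using stackLE_trans }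
  have hanti : IsAntichain (CodedLe (codedSet stackLE)) {n : ℕ | n.bodd = true} :=
    fun x hx y hy hne h => hne (eq_of_stackLE_of_odd hx hy ((hle x y).1 h))
  have hunb : ∀ x : ℕ, ∃ y, x < y ∧ y ∈ {n : ℕ | n.bodd = true} := fun x =>
    ⟨2 * x + 1, by omega, by simp⟩
  refine ⟨⟨_, univ_mem_REC⟩, ⟨_, codedSet_mem_REC primrecRel_stackLE⟩, hpo,
    ⟨_, odd_mem_REC, Set.subset_univ _, ?_, hanti⟩, ?_, ?_⟩
  · exact Set.infinite_of_forall_exists_gt fun x => (hunb x).imp fun y h => ⟨h.2, h.1⟩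
  · rintro I hI ⟨-, hdown⟩
    obtain ⟨F, hF, h⟩ := exists_finite_generators hI fun x y hxy =>
      hdown x trivial y trivial ((hle x y).2 hxy)
    exact ⟨F, hF, Set.subset_univ _, h.trans (by simp [downClosure, hle])⟩
  · intro e E h0 h1
    have h0' : (E 0 : Set ℕ) = Set.univ := by rw [h0]
    have h1' : (E 1 : Set ℕ) = codedSet stackLE := by rw [h1]
    refine ⟨by rwa [sat_partialOrderF, h0', h1'], ?_, ?_⟩
    · exact sat_allIntervalsFiniteUnionF_of_downClosure primrecRel_stackLE (fun x => Or.inl rfl)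
        (fun _ _ _ => stackLE_trans) (fun I hI => exists_finite_generators hI) h0' h1'
    · rw [sat_noInfiniteAntichainF, not_not, h0', h1']
      exact ⟨⟨_, odd_mem_REC⟩, fun _ _ => trivial, fun x y hx hy hne =>
        ⟨hanti hx hy hne, hanti hy hx hne.symm⟩, hunb⟩

theorem not_models_REC : ¬ Models REC finiteUnionsImplyNoInfiniteAntichain := by
  obtain ⟨P, R, -, -, -, h⟩ := exists_counterexample
  intro hM
  obtain ⟨hpo, hfin, hanti⟩ := h (fun _ => 0) (update (update (fun _ => P) 0 P) 1 R)
    (by simp) (by simp)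
  exact hanti (hM _ (fun _ => P) P R hpo hfin)

end SecondOrderArith

open SecondOrderArith in
theorem theorem5p12 :
    -- `RCA₀` does not prove the statement
    ¬ Provable RCA0 finiteUnionsImplyNoInfiniteAntichain ∧
    -- `REC` is an `ω`-model of `RCA₀` in which the statement fails
    (∀ φ ∈ RCA0, Models REC φ) ∧
    ¬ Models REC finiteUnionsImplyNoInfiniteAntichain ∧
    -- the counterexample: a computable partial order `(P, R)` with an infinite computable
    -- antichain, whose computable initial intervals are downward closures of finite sets, and
    -- which satisfies in `REC` the hypothesis but not the conclusion of the statement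
    ∃ P R : REC,
      IsCodedPartialOrder P R ∧
      (∃ D ∈ REC, D ⊆ P ∧ D.Infinite ∧ IsAntichain (CodedLe R) D) ∧
      (∀ I ∈ REC, IsInitialInterval P R I →
        ∃ F : Set ℕ, F.Finite ∧ F ⊆ P ∧ I = downClosure P R F) ∧
      ∀ (e : ℕ → ℕ) (E : ℕ → REC), E 0 = P → E 1 = R →
        Sat REC e E (partialOrderF 0 1) ∧
        Sat REC e E (allIntervalsFiniteUnionF 0 1) ∧
        ¬ Sat REC e E (noInfiniteAntichainF 0 1) :=
  ⟨fun h => not_models_REC (h.models fun _ => models_REC_of_mem_RCA0),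
    fun _ => models_REC_of_mem_RCA0, not_models_REC, exists_counterexample⟩
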